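/- Let $p$ be a prime, $h\ge 2$ an integer and $q=p^{2h}$. An $[n,n-r]_q2$ code is a linear subspace $C\subseteq\mathbb F_q^n$ of dimension $n-r$ with covering radius $2$; that is, $2$ is the least integer $\rho$ such that every vector of $\mathbb F_q^n$ is at Hamming distance at most $\rho$ from some codeword of $C$. Let $\phi(\sqrt q)$ be the order of the largest proper subfield of the field $\mathbb F_{\sqrt q}$ with $\sqrt q=p^h$ elements, and put $$f_q(r,2)=\begin{cases} q^{(r-7)/2}+q^{(r-9)/2}, & r\in\{9,13\},\\ 0, & \text{otherwise.}\end{cases}$$ Then the following infinite families of codes exist. (1) If $p\ge 3$, then for every odd $r=2t+1$ with $t\ge1$ there is an $[n,n-r]_q2$ code of length $$n=\left(2+2\,\frac{\sqrt q-1}{\sqrt q\,(\phi(\sqrt q)-1)}\right)q^{(r-2)/2}+2\left\lfloor q^{(r-5)/2}\right\rfloor+f_q(r,2).$$ (2) If $p\ge 7$, then for every odd $r=2t+1$ with $t\ge1$ there is an $[n,n-r]_q2$ code of length $$n=\left(2+\frac2p+\frac2{\sqrt q}\right)q^{(r-2)/2}+2\left\lfloor q^{(r-5)/2}\right\rfloor+f_q(r,2).$$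 -/

import Mathlib

namespace CoveringCode

/-- `ρ` is the covering radius of the linear code `C` of length `n`: the least integer such that
the Hamming spheres of radius `ρ` centred at the codewords cover the whole space. -/
def HasCoveringRadius {F : Type*} [Field F] {n : ℕ} (C : Submodule F (Fin n → F)) (ρ : ℕ) : Prop :=
  open Classical in
  IsLeast {s : ℕ | ∀ v : Fin n → F, ∃ c ∈ C, hammingDist v c ≤ s} ρ

/-- `C` is an `[n, n - r]_q ρ` code over `F`, where `q = |F|`: a linear code of length `n`,
dimension `n - r` (an honest subtraction, so `r ≤ n`) and covering radius `ρ`. -/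
structure IsCode {F : Type*} [Field F] {n : ℕ} (C : Submodule F (Fin n → F)) (r ρ : ℕ) : Prop where
  dim_add : Module.finrank F C + r = n
  radius : HasCoveringRadius C ρ

/-- `φ`: the order of the largest proper subfield of the (finite, non-prime) field `K`. -/
noncomputable def largestProperSubfieldOrder (K : Type*) [Field K] : ℕ :=
  sSup {m : ℕ | ∃ L : Subfield K, L ≠ ⊤ ∧ Nat.card L = m}

open Classical in
/-- `f_q(r, R)`: equal to `q^((r-3R)/R - 1/2) + q^((r-4R)/R - 1/2)` if `r` is `9R/2` or `13R/2`,
and `0` otherwise. -/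
noncomputable def lengthCorrection (q r R : ℝ) : ℝ :=
  if r = 9 * R / 2 ∨ r = 13 * R / 2 then
    q ^ ((r - 3 * R) / R - 1 / 2) + q ^ ((r - 4 * R) / R - 1 / 2)
  else 0

end CoveringCode

/-!
A code of codimension `r` and covering radius `2` is the same as a family of vectors in `F ^ r`
such that each vector is a linear combination of two of them. The codes are built from the
stronger notion of a pair cover (`IsPairCover`), in which each nonzero vector has to be a
combination, with nonzero coefficients, of two members from distinct classes.

*Codimension 3.* Let `K` be the subfield of order `√q` of `F`. Each point of the plane over `F`
lies on a line of the Baer subplane over `K`, so the union of two disjoint blocking sets of the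
subplane is a pair cover (`isPairCover_of_disjoint`). Linear sets provide small blocking sets: if
`L` is a subfield of `K`, an `L`-subspace of `K ^ 3` of dimension `[K : L] + 1` meets the kernel of
every functional on `K ^ 3`. The subspace of the vectors `(x, x ^ |L|, c)` yields
`√q + (√q - 1) / (|L| - 1)` points, and that of the vectors `(x, T x, c)`, where `T : K → L` is
`L`-linear and nonzero, yields `√q + √q / |L| + 1` points. In both cases a second blocking set of
the same size and disjoint from the first exists as soon as an auxiliary map `K → K` omits some
value: `x ↦ x * C x ^ (|L| - 1)` in the first case (`exists_linearEquiv_mul_pow_ne`), and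
`x ↦ x * (1 + T x * d)` in the second (`exists_mul_one_add_smul_ne`). Since `K` is finite, it is
enough that these maps are not injective.

*Higher codimension.* Let `E` be the extension of `F` of degree `m`. Replacing each vector `g i` of
a pair cover by the vectors `(g i, w)`, where `w` runs through a member `β i` of the Desarguesian
spread of `E × E`, raises the codimension by `2 m` and multiplies the length by `q ^ m`. The result
is again a pair cover, provided that `β` separates the classes and that every spread member is used
(`IsPairCover.concat`). The initial family is too short for this, but for `m = 1` two extra vectors
make up for the missing spread members (`IsPairCover.concat_of_injective`). This gives length
`q n₀ + 2` in codimension 5, and from there on the step applies without extra vectors, with `m = 1`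
up to codimension 9 and with suitably growing `m` afterwards (`HasPairCover.exists_codim`). The
number of classes at most doubles each time and stays below the number of spread members. For
`k ≥ 1`, the resulting lengths are `n₀ q ^ k + 2 q ^ (k - 1)` in codimension `2 k + 3`; where the
required length is larger, zero columns are appended to the parity check matrix.
-/

namespace CoveringCode

/-! ### Pair covers and the codes they define -/

/-- A family `g` of vectors with classes `c` is a pair cover if every nonzero vector is a linear
combination, with two nonzero coefficients, of two members of the family from distinct classes. -/
def IsPairCover (F : Type*) [Field F] {ι κ V : Type*} [AddCommGroup V] [Module F V]
    (g : ι → V) (c : ι → κ) : Prop :=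
  ∀ v : V, v ≠ 0 → ∃ i j, c i ≠ c j ∧ ∃ a b : F, a ≠ 0 ∧ b ≠ 0 ∧ v = a • g i + b • g j

/-- `F ^ r` has a pair cover consisting of `N` vectors in (at most) `P` classes. -/
def HasPairCover (F : Type*) [Field F] (r N P : ℕ) : Prop :=
  ∃ (g : Fin N → Fin r → F) (c : Fin N → Fin P), IsPairCover F g c

theorem IsPairCover.hasPairCover {F : Type*} [Field F] {ι κ V : Type*} [AddCommGroup V]
    [Module F V] [FiniteDimensional F V] [Finite ι] [Finite κ] {g : ι → V} {c : ι → κ}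
    (hg : IsPairCover F g c) {r N P : ℕ} (hr : Module.finrank F V = r) (hN : Nat.card ι = N)
    (hP : Nat.card κ = P) : HasPairCover F r N P := by
  let eV : V ≃ₗ[F] (Fin r → F) := LinearEquiv.ofFinrankEq _ _ (by simpa using hr)
  let eι : ι ≃ Fin N := Finite.equivFinOfCardEq hN
  let eκ : κ ≃ Fin P := Finite.equivFinOfCardEq hP
  refine ⟨fun i => eV (g (eι.symm i)), fun i => eκ (c (eι.symm i)), fun v hv => ?_⟩
  obtain ⟨i, j, hij, a, b, ha, hb, h⟩ := hg (eV.symm v) (by simpa using hv)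
  refine ⟨eι i, eι j, by simpa using hij, a, b, ha, hb, ?_⟩
  rw [← eV.apply_symm_apply v, h]
  simp

theorem HasPairCover.exists_fin {F : Type*} [Field F] {r N P n : ℕ} (h : HasPairCover F r N P)
    (hr : 0 < r) (hn : N ≤ n) : ∃ g : Fin n → Fin r → F,
      ∀ v, ∃ i j, ∃ a b : F, v = a • g i + b • g j := by
  obtain ⟨g, c, hg⟩ := h
  have : Nonempty (Fin r) := ⟨⟨0, hr⟩⟩
  refine ⟨fun k => if hk : (k : ℕ) < N then g ⟨k, hk⟩ else 0, fun v => ?_⟩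
  by_cases hv : v = 0
  · obtain ⟨w, hw⟩ := exists_ne (0 : Fin r → F)
    obtain ⟨i, -⟩ := hg w hw
    exact ⟨Fin.castLE hn i, Fin.castLE hn i, 0, 0, by simp [hv]⟩
  · obtain ⟨i, j, -, a, b, -, -, h⟩ := hg v hv
    exact ⟨Fin.castLE hn i, Fin.castLE hn j, a, b, by simp [h]⟩

open Classical in
theorem hammingNorm_single_add_single_le {F : Type*} [Field F] {n : ℕ} (i j : Fin n) (a b : F) :
    hammingNorm (Pi.single i a + Pi.single j b : Fin n → F) ≤ 2 := by
  unfold hammingNorm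
  refine (Finset.card_le_card (t := {i, j}) fun k hk => ?_).trans Finset.card_le_two
  by_contra hk'
  simp only [Finset.mem_insert, Finset.mem_singleton, not_or] at hk'
  simp [hk'.1, hk'.2] at hk

open Classical in
theorem exists_eq_single_of_hammingNorm_le_one {F : Type*} [Field F] {n : ℕ} [Nonempty (Fin n)]
    {e : Fin n → F} (he : hammingNorm e ≤ 1) : ∃ i a, e = Pi.single i a := by
  unfold hammingNorm at he
  obtain ⟨i, hi⟩ := Finset.card_le_one_iff_subset_singleton.1 he
  refine ⟨i, e i, funext fun k => ?_⟩
  by_cases hk : k = i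
  · subst hk; simp
  · by_contra h
    have : k ∈ ({i} : Finset (Fin n)) := hi (by simpa [hk] using h)
    simp [hk] at this

/-- The vectors of a pair cover are the columns of a parity check matrix of a code of covering
radius `2`. Zero columns may be appended as long as the multiples of single columns do not
exhaust the syndromes, which is what `hlt` ensures. -/
theorem HasPairCover.exists_isCode {F : Type*} [Field F] [Finite F] {r N P n : ℕ}
    (h : HasPairCover F r N P) (hr : 0 < r) (hn : N ≤ n) (hlt : n * Nat.card F < Nat.card F ^ r) :
    ∃ C : Submodule F (Fin n → F), IsCode C r 2 := by
  classical
  obtain ⟨g, hg⟩ := h.exists_fin hr hn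
  have : Nonempty (Fin n) := ⟨(hg 0).choose⟩
  let H : (Fin n → F) →ₗ[F] (Fin r → F) := Fintype.linearCombination F g
  have hH : ∀ i a, H (Pi.single i a) = a • g i := fun i a =>
    Fintype.linearCombination_apply_single F g i a
  have hsurj : LinearMap.range H = ⊤ := by
    refine LinearMap.range_eq_top.2 fun v => ?_
    obtain ⟨i, j, a, b, rfl⟩ := hg v
    exact ⟨Pi.single i a + Pi.single j b, by simp [hH]⟩
  refine ⟨LinearMap.ker H, ⟨?_, fun v => ?_, fun s hs => ?_⟩⟩
  · have := LinearMap.finrank_range_add_finrank_ker H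
    rw [hsurj] at this
    simp only [finrank_top, Module.finrank_fin_fun] at this
    omega
  · obtain ⟨i, j, a, b, hv⟩ := hg (H v)
    refine ⟨v - (Pi.single i a + Pi.single j b), by simp [hH, hv], ?_⟩
    rw [hammingDist_comm, hammingDist_eq_hammingNorm, neg_sub, sub_add_cancel]
    convert hammingNorm_single_add_single_le i j a b
  · by_contra hs2
    refine hlt.not_ge ?_
    have : Function.Surjective fun x : Fin n × F => x.2 • g x.1 := fun u => by
      obtain ⟨v, rfl⟩ := LinearMap.range_eq_top.1 hsurj u
      obtain ⟨c, hc, hd⟩ := hs v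
      rw [hammingDist_comm, hammingDist_eq_hammingNorm] at hd
      have hle : hammingNorm (-c + v) ≤ 1 := hd.trans (by omega)
      obtain ⟨i, a, hia⟩ := exists_eq_single_of_hammingNorm_le_one (e := -c + v) (by convert hle)
      refine ⟨(i, a), ?_⟩
      change a • g i = H v
      rw [← hH, ← hia, map_add, map_neg, LinearMap.mem_ker.1 hc, neg_zero, zero_add]
    simpa [Nat.card_prod, Nat.card_fun] using Nat.card_le_card_of_surjective _ this

/-! ### Concatenation with a spread -/

/-- The members of the Desarguesian spread of `E × E`, each parametrized by `E`: the lines through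
the origin of slope `b : E`, and the vertical line, labelled `none`. -/
def spreadLine {E : Type*} [Field E] : Option E → E →ₗ[E] E × E
  | some b => LinearMap.prod LinearMap.id (b • LinearMap.id)
  | none => LinearMap.inr E E E

section Spread

variable {E : Type*} [Field E]

theorem exists_spreadLine_eq (w : E × E) : ∃ β ξ, spreadLine β ξ = w := by
  obtain ⟨x, y⟩ := w
  by_cases hx : x = 0
  · exact ⟨none, y, by simp [spreadLine, hx]⟩
  · exact ⟨some (y / x), x, by simp [spreadLine, hx]⟩

theorem exists_spreadLine_add_eq {β β' : Option E} (h : β ≠ β') (w : E × E) :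
    ∃ ξ ξ', spreadLine β ξ + spreadLine β' ξ' = w := by
  obtain ⟨x, y⟩ := w
  match β, β' with
  | none, none => exact absurd rfl h
  | none, some b => exact ⟨y - b * x, x, by simp [spreadLine]⟩
  | some b, none => exact ⟨x, y - b * x, by simp [spreadLine]⟩
  | some b, some b' =>
    have hb : b - b' ≠ 0 := sub_ne_zero.2 fun hb => h (by rw [hb])
    refine ⟨(y - b' * x) / (b - b'), (b * x - y) / (b - b'), ?_⟩
    ext <;> simp [spreadLine] <;> field_simp <;> ring

variable {F : Type*} [Field F] [Algebra F E] {ι κ V : Type*} [AddCommGroup V] [Module F V]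

theorem exists_smul_add_smul_eq {g : ι → V} {β : ι → Option E} {i j : ι} {a b : F} (ha : a ≠ 0)
    (hb : b ≠ 0) (hβ : β i ≠ β j) (w : E × E) :
    ∃ ξ ξ' : E, (a • g i + b • g j, w) =
      a • (g i, spreadLine (β i) ξ) + b • (g j, spreadLine (β j) ξ') := by
  obtain ⟨ξ, ξ', rfl⟩ := exists_spreadLine_add_eq hβ w
  refine ⟨a⁻¹ • ξ, b⁻¹ • ξ', ?_⟩
  simp [LinearMap.map_smul_of_tower, ha, hb]

/-- The concatenation step. The spread members `β i` must separate the classes, so that the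
vectors with nonzero first component are covered, and all of them must occur, so that the vectors
with zero first component are covered: each such vector lies on a spread member, hence is the
difference of two columns with the same index `i`. Splitting each class according to whether the
parameter vanishes keeps those two columns in distinct classes. -/
theorem IsPairCover.concat {g : ι → V} {c : ι → κ} (hg : IsPairCover F g c) (β : ι → Option E)
    (hβ : Function.Surjective β) (hc : ∀ i j, c i ≠ c j → β i ≠ β j) :
    IsPairCover F (fun x : ι × E => (g x.1, spreadLine (β x.1) x.2))
      (fun x : ι × E => (c x.1, x.2 = 0)) := by
  rintro ⟨s, w⟩ hsw
  by_cases hs : s = 0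
  · obtain ⟨b, ξ, rfl⟩ := exists_spreadLine_eq w
    obtain ⟨i, rfl⟩ := hβ b
    have hξ : ξ ≠ 0 := fun h => hsw (by simp [h, hs])
    exact ⟨(i, ξ), (i, 0), by simp [hξ], 1, -1, by simp, by simp, by simp [hs]⟩
  · obtain ⟨i, j, hij, a, b, ha, hb, rfl⟩ := hg s hs
    obtain ⟨ξ, ξ', h⟩ := exists_smul_add_smul_eq (g := g) ha hb (hc i j hij) w
    exact ⟨(i, ξ), (j, ξ'), fun h => hij (Prod.ext_iff.1 h).1, a, b, ha, hb, h⟩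

open Classical in
/-- The concatenation step when the family is too short for all spread members to occur and
`E = F`. Two extra columns, spanning the vectors with zero first component, make up for the
missing spread members. The combinations in which one of their coefficients would vanish are
obtained from the index `i₀` or `i₁`; it is only for these that a class has to be split. -/
theorem IsPairCover.concat_of_injective {g : ι → V} (hg : IsPairCover F g (id : ι → ι))
    (β : ι → Option F) (hβ : Function.Injective β) {i₀ i₁ : ι} (h₀₁ : i₀ ≠ i₁) :
    IsPairCover F
      (Sum.elim (fun x : ι × F => (g x.1, spreadLine (β x.1) x.2))
        (fun b : Bool => (0, spreadLine (β (bif b then i₁ else i₀)) 1)))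
      (Sum.elim
        (fun x : ι × F => if x.2 = 0 then
          (if x.1 = i₀ then Sum.inr false else if x.1 = i₁ then Sum.inr true else Sum.inl x.1)
          else Sum.inl x.1)
        Sum.inr : (ι × F) ⊕ Bool → ι ⊕ Bool) := by
  rintro ⟨s, w⟩ hsw
  by_cases hs : s = 0
  · obtain ⟨ξ, ξ', rfl⟩ := exists_spreadLine_add_eq (hβ.ne h₀₁) w
    by_cases hξ : ξ = 0
    · have hξ' : ξ' ≠ 0 := fun h => hsw (by simp [h, hξ, hs])
      exact ⟨.inl (i₁, ξ'), .inl (i₁, 0), by simp [hξ', h₀₁.symm], 1, -1, by simp, by simp,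
        by simp [hs, hξ]⟩
    by_cases hξ' : ξ' = 0
    · exact ⟨.inl (i₀, ξ), .inl (i₀, 0), by simp [hξ], 1, -1, by simp, by simp,
        by simp [hs, hξ']⟩
    refine ⟨.inr false, .inr true, by simp, ξ, ξ', hξ, hξ', ?_⟩
    simp only [Sum.elim_inr, cond_false, cond_true, Prod.smul_mk, smul_zero, Prod.mk_add_mk,
      add_zero, hs, ← map_smul, smul_eq_mul, mul_one]
  · obtain ⟨i, j, hij, a, b, ha, hb, rfl⟩ := hg s hs
    obtain ⟨ξ, ξ', h⟩ := exists_smul_add_smul_eq (g := g) ha hb (hβ.ne hij) w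
    refine ⟨.inl (i, ξ), .inl (j, ξ'), ?_, a, b, ha, hb, h⟩
    simp only [Sum.elim_inl, id] at hij ⊢
    grind

end Spread

/-! ### Double blocking sets in Baer subplanes -/

section Baer

variable {L K F : Type*} [Field L] [Field K] [Field F] [Algebra L K] [Algebra K F]

/-- The points of a linear set of rank `[K : L] + 1` form a blocking set. -/
theorem exists_ne_zero_apply_eq_zero [FiniteDimensional L K] (Φ : K × L →ₗ[L] Fin 3 → K)
    (f : Module.Dual K (Fin 3 → K)) : ∃ y ≠ 0, f (Φ y) = 0 := by
  have h : LinearMap.ker ((f.restrictScalars L) ∘ₗ Φ) ≠ ⊥ :=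
    LinearMap.ker_ne_bot_of_finrank_lt (by simp)
  obtain ⟨y, hy, hy0⟩ := (Submodule.ne_bot_iff _).1 h
  exact ⟨y, hy0, by simpa using hy⟩

/-- A point of a linear set of rank `[K : L] + 1` lies on a line containing two further points
of it. -/
theorem exists_add_eq_apply [FiniteDimensional L K] {Φ : K × L →ₗ[L] Fin 3 → K}
    (hΦ : Function.Injective Φ) {y : K × L} (hy : y ≠ 0) :
    ∃ y₁ y₂, y₁ ≠ 0 ∧ y₂ ≠ 0 ∧ y = y₁ + y₂ ∧ ∀ c : K, Φ y₂ ≠ c • Φ y₁ := by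
  have hΦy : Φ y ≠ 0 := fun h => hy (hΦ (by simp [h]))
  obtain ⟨f, hf⟩ : ∃ f : Module.Dual K (Fin 3 → K), f (Φ y) ≠ 0 := by
    by_contra! h
    exact hΦy ((Module.forall_dual_apply_eq_zero_iff K _).1 h)
  obtain ⟨y₁, hy₁, h₁⟩ := exists_ne_zero_apply_eq_zero Φ f
  have h₂ : ∀ c : K, Φ (y - y₁) ≠ c • Φ y₁ := fun c hc => hf <| by
    have := congrArg f hc
    simpa [h₁] using this
  exact ⟨y₁, y - y₁, hy₁, fun h => h₂ 0 (by simp [h]), by simp, h₂⟩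

/-- Two vectors on a line of the Baer subplane which represent different points
span it. -/
theorem exists_eq_smul_add_smul {x y : Fin 3 → K} (h : LinearIndependent K ![x, y])
    {f : Module.Dual K (Fin 3 → K)} (hf : f ≠ 0) (hx : f x = 0) (hy : f y = 0)
    {z : Fin 3 → K} (hz : f z = 0) : ∃ a b : K, z = a • x + b • y := by
  have hle : Submodule.span K (Set.range ![x, y]) ≤ LinearMap.ker f := by
    rw [Submodule.span_le]
    rintro _ ⟨i, rfl⟩
    fin_cases i <;> simpa
  have hker : Module.finrank K (LinearMap.ker f) = 2 := by
    have := Module.Dual.finrank_ker_add_one_of_ne_zero hf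
    simp only [Module.finrank_fin_fun] at this
    omega
  have heq := Submodule.eq_of_le_of_finrank_eq hle (by
    rw [finrank_span_eq_card h, hker, Fintype.card_fin])
  have hz' : z ∈ Submodule.span K (Set.range ![x, y]) := by rw [heq]; exact hz
  rw [Matrix.range_cons_cons_empty, Submodule.mem_span_pair] at hz'
  obtain ⟨a, b, h⟩ := hz'
  exact ⟨a, b, h.symm⟩

/-- The extension of a vector of `K ^ 3` to `F ^ 3`, for a field extension `F` of `K`. -/
def extendVec (F : Type*) {K : Type*} [Field K] [Field F] [Algebra K F] (x : Fin 3 → K) :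
    Fin 3 → F :=
  fun k => algebraMap K F (x k)

/-- Two vectors of `K ^ 3` lie on a common line of the plane over `K`. As `F` is a quadratic
extension, this says that each vector of `F ^ 3` lies on a line of the Baer subplane. -/
theorem exists_dual_and_extendVec (hF : Module.finrank K F = 2) (v : Fin 3 → F) :
    ∃ f : Module.Dual K (Fin 3 → K), f ≠ 0 ∧ ∃ x y : Fin 3 → K, f x = 0 ∧ f y = 0 ∧
      ∃ a b : F, v = a • extendVec F x + b • extendVec F y := by
  have : FiniteDimensional K F := Module.finite_of_finrank_pos (by omega)
  let e := Module.finBasisOfFinrankEq K F hF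
  let x : Fin 3 → K := fun k => e.repr (v k) 0
  let y : Fin 3 → K := fun k => e.repr (v k) 1
  have hlt : Submodule.span K (Set.range ![x, y]) < ⊤ := by
    rw [lt_top_iff_ne_top]
    intro h
    have h₁ := finrank_range_le_card (R := K) ![x, y]
    rw [Set.finrank, h] at h₁
    simp at h₁
  obtain ⟨f, hf, hle⟩ := Submodule.exists_le_ker_of_lt_top _ hlt
  refine ⟨f, hf, x, y, hle (Submodule.subset_span ⟨0, rfl⟩),
    hle (Submodule.subset_span ⟨1, rfl⟩), e 0, e 1, funext fun k => ?_⟩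
  have := e.sum_repr (v k)
  rw [Fin.sum_univ_two] at this
  simp only [Pi.add_apply, Pi.smul_apply, extendVec, smul_eq_mul]
  rw [← this, Algebra.smul_def, Algebra.smul_def]
  simp only [x, y]
  ring

theorem extendVec_add (x y : Fin 3 → K) :
    extendVec F (x + y) = extendVec F x + extendVec F y := by
  ext; simp [extendVec]

theorem extendVec_smul (a : K) (x : Fin 3 → K) :
    extendVec F (a • x) = algebraMap K F a • extendVec F x := by
  ext; simp [extendVec]

/-- The union of two disjoint linear blocking sets of a Baer subplane is a pair cover of the
ambient plane: a point of the ambient plane lies on a line of the subplane, and is spanned by a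
point of each blocking set on that line. If it happens to be one of these points, it is spanned
by two other points of the same blocking set. -/
theorem isPairCover_of_disjoint [FiniteDimensional L K] (hF : Module.finrank K F = 2)
    {Φ Ψ : K × L →ₗ[L] Fin 3 → K} (hΦ : Function.Injective Φ) (hΨ : Function.Injective Ψ)
    (hdisj : ∀ y z, y ≠ 0 → ∀ c : K, c ≠ 0 → Φ y ≠ c • Ψ z)
    {ι κ : Type*} {g : ι → Fin 3 → K} {g' : κ → Fin 3 → K}
    (hg : ∀ y, y ≠ 0 → ∃ i, ∃ c : K, c ≠ 0 ∧ Φ y = c • g i)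
    (hg' : ∀ y, y ≠ 0 → ∃ i, ∃ c : K, c ≠ 0 ∧ Ψ y = c • g' i) :
    IsPairCover F (fun i : ι ⊕ κ => extendVec F (Sum.elim g g' i)) (id : ι ⊕ κ → ι ⊕ κ) := by
  have hmem : ∀ (Θ : K × L →ₗ[L] Fin 3 → K) (u : ι ⊕ κ → Fin 3 → K), Function.Injective Θ →
      (∀ y, y ≠ 0 → ∃ i, ∃ c : K, c ≠ 0 ∧ Θ y = c • u i) → ∀ y, y ≠ 0 → ∀ a : F, a ≠ 0 →
      ∃ i j, i ≠ j ∧ ∃ b c : F, b ≠ 0 ∧ c ≠ 0 ∧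
        a • extendVec F (Θ y) = b • extendVec F (u i) + c • extendVec F (u j) := by
    intro Θ u hΘ hu y hy a ha
    obtain ⟨y₁, y₂, hy₁, hy₂, rfl, hne⟩ := exists_add_eq_apply hΘ hy
    obtain ⟨i, c, hc, hi⟩ := hu y₁ hy₁
    obtain ⟨j, d, hd, hj⟩ := hu y₂ hy₂
    refine ⟨i, j, ?_, a * algebraMap K F c, a * algebraMap K F d, by simp [ha, hc],
      by simp [ha, hd], ?_⟩
    · rintro rfl
      exact hne (d * c⁻¹) (by rw [hi, hj, smul_smul, inv_mul_cancel_right₀ hc])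
    · rw [map_add, hi, hj, extendVec_add, extendVec_smul, extendVec_smul, smul_add, smul_smul,
        smul_smul]
  have hl : ∀ y, y ≠ 0 → ∃ i, ∃ c : K, c ≠ 0 ∧ Φ y = c • (Sum.elim g g' i) := fun y hy => by
    obtain ⟨i, h⟩ := hg y hy
    exact ⟨.inl i, h⟩
  have hr : ∀ y, y ≠ 0 → ∃ i, ∃ c : K, c ≠ 0 ∧ Ψ y = c • (Sum.elim g g' i) := fun y hy => by
    obtain ⟨i, h⟩ := hg' y hy
    exact ⟨.inr i, h⟩
  intro v hv
  obtain ⟨f, hf, x₁, x₂, hx₁, hx₂, p, q, rfl⟩ := exists_dual_and_extendVec hF v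
  obtain ⟨y, hy, hfy⟩ := exists_ne_zero_apply_eq_zero Φ f
  obtain ⟨z, hz, hfz⟩ := exists_ne_zero_apply_eq_zero Ψ f
  have hΨz : Ψ z ≠ 0 := fun h => hz (hΨ (by simp [h]))
  have hind : LinearIndependent K ![Ψ z, Φ y] := by
    rw [LinearIndependent.pair_iff' hΨz]
    intro a ha
    refine hdisj y z hy a ?_ ha.symm
    rintro rfl
    exact hy (hΦ (by rw [← ha, zero_smul, map_zero]))
  obtain ⟨a₁, b₁, h₁⟩ := exists_eq_smul_add_smul hind hf hfz hfy hx₁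
  obtain ⟨a₂, b₂, h₂⟩ := exists_eq_smul_add_smul hind hf hfz hfy hx₂
  obtain ⟨a, b, hab⟩ : ∃ a b : F, p • extendVec F x₁ + q • extendVec F x₂ =
      a • extendVec F (Φ y) + b • extendVec F (Ψ z) := by
    refine ⟨p * algebraMap K F b₁ + q * algebraMap K F b₂,
      p * algebraMap K F a₁ + q * algebraMap K F a₂, ?_⟩
    rw [h₁, h₂]
    simp only [extendVec_add, extendVec_smul]
    module
  rw [hab] at hv ⊢
  by_cases ha : a = 0
  · have hb : b ≠ 0 := by
      rintro rfl
      simp [ha] at hv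
    rw [ha, zero_smul, zero_add]
    exact hmem Ψ _ hΨ hr z hz b hb
  by_cases hb : b = 0
  · rw [hb, zero_smul, add_zero]
    exact hmem Φ _ hΦ hl y hy a ha
  obtain ⟨i, c, hc, hi⟩ := hg y hy
  obtain ⟨j, d, hd, hj⟩ := hg' z hz
  refine ⟨.inl i, .inr j, by simp, a * algebraMap K F c, b * algebraMap K F d, by simp [ha, hc],
    by simp [hb, hd], ?_⟩
  simp only [hi, hj, extendVec_smul, smul_smul, Sum.elim_inl, Sum.elim_inr]

end Baer

/-! ### Disjoint linear blocking sets of Frobenius type -/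

theorem exists_linearEquiv_pair {L K : Type*} [Field L] [Field K] [Algebra L K]
    {x y x' y' : K} (h : LinearIndependent L ![x, y]) (h' : LinearIndependent L ![x', y']) :
    ∃ C : K ≃ₗ[L] K, C x = x' ∧ C y = y' := by
  have := FiniteDimensional.span_of_finite L (Set.finite_range ![x, y])
  obtain ⟨C, hC⟩ := Submodule.exists_linearEquiv_restrict_eq
    ((Module.Basis.span h).equiv (Module.Basis.span h') (Equiv.refl _))
  have key : ∀ i, C (![x, y] i) = ![x', y'] i := fun i => by
    have h₁ := hC (Module.Basis.span h i)
    rw [Module.Basis.equiv_apply, Module.Basis.span_apply, Module.Basis.span_apply] at h₁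
    exact h₁.symm
  exact ⟨C, key 0, key 1⟩

theorem linearIndependent_one_pair {L K : Type*} [Field L] [Field K] [Algebra L K] {z : K}
    (hz : ∀ a : L, algebraMap L K a ≠ z) : LinearIndependent L ![1, z] := by
  rw [LinearIndependent.pair_iff' one_ne_zero]
  intro a ha
  exact hz a (by rw [← ha, Algebra.smul_def, mul_one])

section Frobenius

variable {L K : Type*} [Field L] [Fintype L] [Field K] [Algebra L K]

theorem algebraMap_pow_card_sub_one {a : L} (ha : a ≠ 0) :
    algebraMap L K a ^ (Fintype.card L - 1) = 1 := by
  rw [← map_pow, FiniteField.pow_card_sub_one_eq_one a ha, map_one]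

/-- A generator of the multiplicative group of `K` has the required properties. -/
theorem exists_pow_notMem_range_algebraMap [Finite K] (h : Fintype.card L < Nat.card K) :
    ∃ z : K, (∀ a : L, algebraMap L K a ≠ z) ∧
      ∀ a : L, algebraMap L K a ≠ z ^ (Fintype.card L - 1) := by
  have hL : 1 < Fintype.card L := Fintype.one_lt_card
  have hcard : Fintype.card L ^ 2 ≤ Nat.card K := by
    have hpow := Module.natCard_eq_pow_finrank (K := L) (V := K)
    rw [Nat.card_eq_fintype_card (α := L)] at hpow
    rw [hpow] at h ⊢
    refine Nat.pow_le_pow_right (by omega) ?_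
    exact (Nat.pow_lt_pow_iff_right hL).1 (by simpa using h)
  obtain ⟨u, hu⟩ := IsCyclic.exists_generator (α := Kˣ)
  have horder : orderOf u = Nat.card K - 1 := by
    rw [orderOf_eq_card_of_forall_mem_zpowers hu, Nat.card_units]
  have hkey : ∀ m, 0 < m → m < Nat.card K - 1 → (u : K) ^ m ≠ 1 := fun m h₀ hm h₁ => by
    have h₂ : u ^ m = 1 := Units.ext (by simpa using h₁)
    have := Nat.le_of_dvd h₀ (orderOf_dvd_of_pow_eq_one h₂)
    omega
  obtain ⟨l, hl⟩ : ∃ l, Fintype.card L = l + 2 := ⟨_, (Nat.sub_add_cancel hL).symm⟩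
  rw [hl] at hcard
  have hsq : (l + 2) ^ 2 = (l + 1) * (l + 1) + 2 * l + 3 := by ring
  refine ⟨u, fun a ha => ?_, fun a ha => ?_⟩
  · have ha0 : a ≠ 0 := fun h => u.ne_zero (by rw [← ha, h, map_zero])
    refine hkey (Fintype.card L - 1) (by omega) (by rw [hl]; lia) ?_
    rw [← ha, algebraMap_pow_card_sub_one ha0]
  · have ha0 : a ≠ 0 := fun h => pow_ne_zero _ u.ne_zero (by rw [← ha, h, map_zero])
    have hlt : (l + 1) * (l + 1) < Nat.card K - 1 := by omega
    refine hkey _ (by positivity) hlt ?_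
    have := algebraMap_pow_card_sub_one (K := K) ha0
    rwa [ha, hl, ← pow_mul] at this

/-- For a suitable automorphism `C` of the `L`-space `K`, the map `x ↦ x * C x ^ (|L| - 1)` omits
some value. As `K` is finite it is enough to make it non-injective, and with `C 1 = z` and
`C (z ^ (|L| - 1)) = 1` it takes equal values at `1` and `z ^ (|L| - 1)`. -/
theorem exists_linearEquiv_mul_pow_ne [Finite K] (h : Fintype.card L < Nat.card K) :
    ∃ (C : K ≃ₗ[L] K) (a : K), ∀ x, x * C x ^ (Fintype.card L - 1) ≠ a ^ Fintype.card L := by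
  obtain ⟨z, hz, hzl⟩ := exists_pow_notMem_range_algebraMap h
  have hind : LinearIndependent L ![z, 1] :=
    LinearIndependent.pair_symm_iff.1 (linearIndependent_one_pair hz)
  obtain ⟨C, hC₁, hC₂⟩ := exists_linearEquiv_pair (linearIndependent_one_pair hzl) hind
  have hninj : ¬ Function.Injective fun x : K => x * C x ^ (Fintype.card L - 1) := fun hinj =>
    hzl 1 <| by
      rw [map_one]
      refine hinj (a₁ := 1) (a₂ := z ^ (Fintype.card L - 1)) ?_
      change 1 * C 1 ^ (Fintype.card L - 1) =
        z ^ (Fintype.card L - 1) * C (z ^ (Fintype.card L - 1)) ^ (Fintype.card L - 1)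
      rw [hC₁, hC₂, one_pow, one_mul, mul_one]
  rw [Finite.injective_iff_surjective] at hninj
  simp only [Function.Surjective, not_forall, not_exists] at hninj
  obtain ⟨b, hb⟩ := hninj
  obtain ⟨a, ha⟩ := Finite.surjective_of_injective (FiniteField.frobeniusAlgHom L K).injective b
  change a ^ Fintype.card L = b at ha
  exact ⟨C, a, fun x hx => hb x (hx.trans ha)⟩

/-- The linear set of the vectors `(x, x ^ |L|, c)` with `x : K` and `c : L`. -/
def frobeniusLinearSet (L K : Type*) [Field L] [Fintype L] [Field K] [Algebra L K] :
    K × L →ₗ[L] Fin 3 → K :=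
  LinearMap.pi ![LinearMap.fst L K L, (FiniteField.frobeniusAlgHom L K).toLinearMap ∘ₗ
    LinearMap.fst L K L, Algebra.linearMap L K ∘ₗ LinearMap.snd L K L]

/-- The linear set of the vectors `(a * c, x, C x)` with `x : K` and `c : L`. -/
def twistedLinearSet {L K : Type*} [Field L] [Field K] [Algebra L K] (a : K)
    (C : K ≃ₗ[L] K) : K × L →ₗ[L] Fin 3 → K :=
  LinearMap.pi ![LinearMap.mulLeft L a ∘ₗ Algebra.linearMap L K ∘ₗ LinearMap.snd L K L,
    LinearMap.fst L K L, C.toLinearMap ∘ₗ LinearMap.fst L K L]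

theorem frobeniusLinearSet_injective : Function.Injective (frobeniusLinearSet L K) := by
  rintro ⟨x, c⟩ ⟨x', c'⟩ h
  have h₀ := congrFun h 0
  have h₂ := congrFun h 2
  simp only [frobeniusLinearSet, LinearMap.pi_apply, Matrix.cons_val, LinearMap.comp_apply,
    LinearMap.fst_apply, LinearMap.snd_apply, Algebra.linearMap_apply] at h₀ h₂
  rw [h₀, (algebraMap L K).injective h₂]

theorem twistedLinearSet_injective {L K : Type*} [Field L] [Field K] [Algebra L K]
    {a : K} (ha : a ≠ 0) (C : K ≃ₗ[L] K) :
    Function.Injective (twistedLinearSet a C) := by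
  rintro ⟨x, c⟩ ⟨x', c'⟩ h
  have h₀ := congrFun h 0
  have h₁ := congrFun h 1
  simp only [twistedLinearSet, LinearMap.pi_apply, Matrix.cons_val, LinearMap.comp_apply,
    LinearMap.fst_apply, LinearMap.snd_apply, Algebra.linearMap_apply,
    LinearMap.mulLeft_apply] at h₀ h₁
  rw [h₁, (algebraMap L K).injective (mul_left_cancel₀ ha h₀)]

theorem frobeniusLinearSet_ne_smul_twistedLinearSet {a : K} {C : K ≃ₗ[L] K}
    (hC : ∀ x, x * C x ^ (Fintype.card L - 1) ≠ a ^ Fintype.card L) {y z : K × L} (hy : y ≠ 0)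
    {c : K} (hc : c ≠ 0) : frobeniusLinearSet L K y ≠ c • twistedLinearSet a C z := by
  obtain ⟨y, m⟩ := y
  obtain ⟨x, l⟩ := z
  intro h
  have h₀ := congrFun h 0
  have h₁ := congrFun h 1
  have h₂ := congrFun h 2
  simp only [frobeniusLinearSet, twistedLinearSet, LinearMap.pi_apply, Matrix.cons_val,
    LinearMap.comp_apply, LinearMap.fst_apply, LinearMap.snd_apply, Algebra.linearMap_apply,
    LinearMap.mulLeft_apply, Pi.smul_apply, smul_eq_mul, AlgHom.toLinearMap_apply,
    FiniteField.coe_frobeniusAlgHom, LinearEquiv.coe_coe] at h₀ h₁ h₂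
  have hL : 1 < Fintype.card L := Fintype.one_lt_card
  obtain ⟨q, hq⟩ : ∃ q, Fintype.card L = q + 1 := ⟨_, (Nat.sub_add_cancel hL.le).symm⟩
  have hx : x ≠ 0 := by
    rintro rfl
    rw [mul_zero] at h₁
    rw [map_zero, mul_zero, map_eq_zero] at h₂
    exact hy (Prod.ext (by simpa using h₁) h₂)
  have hy0 : y ≠ 0 := by
    rintro rfl
    rw [zero_pow (by omega)] at h₁
    exact mul_ne_zero hc hx h₁.symm
  have hl : l ≠ 0 := by
    rintro rfl
    exact hy0 (by simpa using h₀)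
  have hm : m ≠ 0 := by
    rintro rfl
    rw [map_zero] at h₂
    exact mul_ne_zero hc (by simpa using hx) h₂.symm
  have hlK : algebraMap L K l ≠ 0 := by simpa using hl
  have hml := algebraMap_pow_card_sub_one (K := K) hm
  have hll := algebraMap_pow_card_sub_one (K := K) hl
  -- The equations are homogeneous over `L`, so that dividing by `l` reduces to `l = 1`.
  refine hC (l⁻¹ • x) ?_
  rw [map_smul, Algebra.smul_def, Algebra.smul_def, mul_pow, map_inv₀, inv_pow, hll, inv_one,
    one_mul]
  rw [h₀, hq, mul_pow, mul_pow] at h₁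
  rw [hq, Nat.add_sub_cancel] at hml hll ⊢
  rw [h₂, mul_pow] at hml
  rw [pow_succ (algebraMap L K l), hll, one_mul] at h₁
  rw [mul_assoc, inv_mul_eq_iff_eq_mul₀ hlK]
  have h₃ : c ^ q * (a ^ (q + 1) * algebraMap L K l) = x :=
    mul_left_cancel₀ hc (by rw [← h₁]; ring)
  linear_combination a ^ (q + 1) * algebraMap L K l * hml - C x ^ q * h₃

theorem exists_rep_apply {L K : Type*} [Field L] [Field K] [Algebra L K]
    {Φ : K × L →ₗ[L] Fin 3 → K} {y : K × L} (hy : y ≠ 0) :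
    ∃ (P : Projectivization L (K × L)) (c : K), c ≠ 0 ∧ Φ y = c • Φ P.rep := by
  obtain ⟨a, ha⟩ := Projectivization.exists_smul_eq_mk_rep L y hy
  refine ⟨Projectivization.mk L y hy, algebraMap L K (a⁻¹ : Lˣ), by simp, ?_⟩
  rw [← ha, Units.smul_def, map_smul, algebraMap_smul, smul_smul, Units.inv_mul, one_smul]

/-- The length is counted by indexing the points of each linear set by the projective space of
`K × L` over `L`. -/
theorem hasPairCover_frobenius [Finite K] {F : Type*} [Field F] [Algebra K F]
    (hF : Module.finrank K F = 2)
    (h : Fintype.card L < Nat.card K) :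
    HasPairCover F 3 (2 * Nat.card (Projectivization L (K × L)))
      (2 * Nat.card (Projectivization L (K × L))) := by
  obtain ⟨C, a, hC⟩ := exists_linearEquiv_mul_pow_ne h
  have ha : a ≠ 0 := by
    rintro rfl
    refine hC 0 ?_
    rw [zero_mul, zero_pow Fintype.card_ne_zero]
  have hcover := isPairCover_of_disjoint (F := F) hF frobeniusLinearSet_injective
    (twistedLinearSet_injective ha C)
    (fun y z hy c hc => frobeniusLinearSet_ne_smul_twistedLinearSet hC hy hc)
    (fun y hy => exists_rep_apply hy) (fun y hy => exists_rep_apply hy)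
  exact hcover.hasPairCover (by simp) (by rw [Nat.card_sum]; ring) (by rw [Nat.card_sum]; ring)

end Frobenius

/-! ### Disjoint linear blocking sets of trace type -/

section Trace

variable {L K : Type*} [Field L] [Field K] [Algebra L K]

/-- If `T 1 = 1`, `T d = 0` and `d ≠ 0`, the map `x ↦ x * (1 + T x * d)` omits some value. As `K`
is finite it is enough to find two arguments with equal values, and these are `x * (1 + d)` and
`x` for any `x` with `T x = 1` and `T (x * d) = -1`. -/
theorem exists_mul_one_add_smul_ne [Finite K] {T : K →ₗ[L] L} (hT : T 1 = 1) {d : K} (hd : d ≠ 0)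
    (hTd : T d = 0) : ∃ w : K, ∀ x, x * (1 + T x • d) ≠ w := by
  have hsurj : Function.Surjective (T.prod (T ∘ₗ LinearMap.mulRight L d)) := by
    rw [← LinearMap.range_eq_top]
    by_contra hne
    obtain ⟨f, hf, hle⟩ := Submodule.exists_le_ker_of_lt_top _ (lt_top_iff_ne_top.2 hne)
    have hsplit : ∀ u v, f (u, v) = u * f (1, 0) + v * f (0, 1) := fun u v => by
      rw [← smul_eq_mul, ← smul_eq_mul, ← map_smul, ← map_smul, ← map_add]
      simp
    have hzero : ∀ x, T (x * (f (1, 0) • 1 + f (0, 1) • d)) = 0 := fun x => by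
      have hx : f (T x, T (x * d)) = 0 := hle ⟨x, rfl⟩
      rw [hsplit] at hx
      rw [mul_add, mul_smul_comm, mul_smul_comm, map_add, map_smul, map_smul, mul_one,
        smul_eq_mul, smul_eq_mul]
      linear_combination hx
    have hcomb : f (1, 0) • (1 : K) + f (0, 1) • d = 0 := by
      by_contra hne'
      have := hzero (f (1, 0) • (1 : K) + f (0, 1) • d)⁻¹
      rw [inv_mul_cancel₀ hne', hT] at this
      exact one_ne_zero this
    have h₁ : f (1, 0) = 0 := by
      have := congrArg T hcomb
      simpa [hT, hTd] using this
    have h₂ : f (0, 1) = 0 := by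
      rw [h₁, zero_smul, zero_add, smul_eq_zero] at hcomb
      exact hcomb.resolve_right hd
    exact hf (LinearMap.ext fun ⟨u, v⟩ => by simp [hsplit u v, h₁, h₂])
  obtain ⟨x, hx⟩ := hsurj (1, -1)
  have hx₁ : T x = 1 := congrArg Prod.fst hx
  have hx₂ : T (x * d) = -1 := congrArg Prod.snd hx
  have hx₃ : T (x * (1 + d)) = 0 := by rw [mul_add, mul_one, map_add, hx₁, hx₂, add_neg_cancel]
  have hninj : ¬ Function.Injective fun x : K => x * (1 + T x • d) := fun hinj => by
    have heq : x * (1 + d) = x := hinj (by simp [hx₁, hx₃])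
    rw [heq, hx₁] at hx₃
    exact one_ne_zero hx₃
  rw [Finite.injective_iff_surjective] at hninj
  simp only [Function.Surjective, not_forall, not_exists] at hninj
  exact hninj

/-- The linear set of the vectors `(x, T x, c)` with `x : K` and `c : L`. -/
def traceLinearSet (T : K →ₗ[L] L) : K × L →ₗ[L] Fin 3 → K :=
  LinearMap.pi ![LinearMap.fst L K L, Algebra.linearMap L K ∘ₗ T ∘ₗ LinearMap.fst L K L,
    Algebra.linearMap L K ∘ₗ LinearMap.snd L K L]

/-- The linear set of the vectors `(c * w, x, c + T x * d)` with `x : K` and `c : L`. -/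
def twistedTraceLinearSet (T : K →ₗ[L] L) (w d : K) : K × L →ₗ[L] Fin 3 → K :=
  LinearMap.pi ![LinearMap.toSpanSingleton L K w ∘ₗ LinearMap.snd L K L, LinearMap.fst L K L,
    Algebra.linearMap L K ∘ₗ LinearMap.snd L K L +
      LinearMap.toSpanSingleton L K d ∘ₗ T ∘ₗ LinearMap.fst L K L]

theorem traceLinearSet_apply (T : K →ₗ[L] L) (x : K) (c : L) :
    traceLinearSet T (x, c) = ![x, algebraMap L K (T x), algebraMap L K c] := by
  ext i
  fin_cases i <;> simp [traceLinearSet]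

theorem twistedTraceLinearSet_apply (T : K →ₗ[L] L) (w d x : K) (c : L) :
    twistedTraceLinearSet T w d (x, c) = ![c • w, x, algebraMap L K c + T x • d] := by
  ext i
  fin_cases i <;> simp [twistedTraceLinearSet]

theorem traceLinearSet_injective (T : K →ₗ[L] L) : Function.Injective (traceLinearSet T) := by
  rintro ⟨x, c⟩ ⟨x', c'⟩ h
  rw [traceLinearSet_apply, traceLinearSet_apply] at h
  have h₀ : x = x' := congrFun h 0
  have h₂ : algebraMap L K c = algebraMap L K c' := congrFun h 2
  rw [h₀, (algebraMap L K).injective h₂]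

theorem twistedTraceLinearSet_injective (T : K →ₗ[L] L) (w d : K) :
    Function.Injective (twistedTraceLinearSet T w d) := by
  rintro ⟨x, c⟩ ⟨x', c'⟩ h
  rw [twistedTraceLinearSet_apply, twistedTraceLinearSet_apply] at h
  have h₁ : x = x' := congrFun h 1
  have h₂ : algebraMap L K c + T x • d = algebraMap L K c' + T x' • d := congrFun h 2
  rw [h₁, add_left_inj] at h₂
  rw [h₁, (algebraMap L K).injective h₂]

theorem traceLinearSet_ne_smul_twistedTraceLinearSet {T : K →ₗ[L] L} (hT : T 1 = 1) {w d : K}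
    (hTd : T d = 0) (hw : ∀ x, x * (1 + T x • d) ≠ w) {y z : K × L} (hy : y ≠ 0) {c : K}
    (hc : c ≠ 0) : traceLinearSet T y ≠ c • twistedTraceLinearSet T w d z := by
  obtain ⟨x, m⟩ := y
  obtain ⟨y, l⟩ := z
  intro h
  rw [traceLinearSet_apply, twistedTraceLinearSet_apply] at h
  have h₀ : x = c * (l • w) := congrFun h 0
  have h₁ : algebraMap L K (T x) = c * y := congrFun h 1
  have h₂ : algebraMap L K m = c * (algebraMap L K l + T y • d) := congrFun h 2
  have hTl : ∀ l : L, T (algebraMap L K l) = l := fun l => by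
    rw [Algebra.algebraMap_eq_smul_one, map_smul, hT, smul_eq_mul, mul_one]
  have h₂' : m • c⁻¹ = algebraMap L K l + T y • d := by
    rw [Algebra.smul_def, h₂]
    field_simp
  have hl : l ≠ 0 := by
    rintro rfl
    rw [zero_smul, mul_zero] at h₀
    have hy0 : y = 0 := by simpa [h₀, hc] using h₁
    rw [hy0] at h₂
    exact hy (Prod.ext h₀ (by simpa using h₂))
  have hTc : m * T c⁻¹ = l := by
    have := congrArg T h₂'
    rwa [map_smul, map_add, map_smul, hTd, smul_zero, add_zero, hTl, smul_eq_mul] at this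
  have hm : m ≠ 0 := by
    rintro rfl
    exact hl (by rw [← hTc, zero_mul])
  have hy' : y = T x • c⁻¹ := by
    rw [Algebra.smul_def, h₁]
    field_simp
  have hTy : T y = T x * T c⁻¹ := by rw [hy', map_smul, smul_eq_mul]
  have hmK : algebraMap L K m ≠ 0 := by simpa using hm
  have hlK : algebraMap L K l ≠ 0 := by simpa using hl
  -- The equations are homogeneous over `L`, so that dividing by `m` reduces to `m = 1`.
  refine hw (m⁻¹ • x) ?_
  have hfac : algebraMap L K l * (1 + T (m⁻¹ • x) • d) = m • c⁻¹ := by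
    rw [h₂', hTy, map_smul, smul_eq_mul, ← hTc]
    simp only [Algebra.smul_def, map_mul, map_inv₀]
    field_simp
  rw [← mul_right_inj' hlK, mul_left_comm, hfac]
  simp only [Algebra.smul_def, map_inv₀] at h₀ ⊢
  rw [h₀]
  field_simp

theorem card_fiber_mul_card [Finite K] {T : K →ₗ[L] L} (hT : T 1 = 1) :
    Nat.card {x // T x = 1} * Nat.card L = Nat.card K := by
  have hfin : Finite L := Finite.of_injective _ (algebraMap L K).injective
  have := Fintype.ofFinite L
  have hTl : ∀ l : L, T (algebraMap L K l) = l := fun l => by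
    rw [Algebra.algebraMap_eq_smul_one, map_smul, hT, smul_eq_mul, mul_one]
  have hfib : ∀ l : L, Nat.card {x // T x = l} = Nat.card {x // T x = 1} := fun l =>
    Nat.card_congr ((Equiv.addRight (algebraMap L K (1 - l))).subtypeEquiv fun x => by
      simp only [Equiv.coe_addRight, map_add, map_sub, map_one, hT, hTl]
      constructor <;> intro h
      · rw [h]; ring
      · linear_combination h)
  rw [← Nat.card_congr (Equiv.sigmaFiberEquiv T), Nat.card_sigma]
  simp only [hfib, Finset.sum_const, Finset.card_univ, smul_eq_mul, Nat.card_eq_fintype_card]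
  ring

/-- Representatives of the points of a linear set in which the subspace of vectors `(x, 0)` with
`T x = 0` is contracted to a single point `e`. -/
def tracePoints (T : K →ₗ[L] L) (Φ : K × L →ₗ[L] Fin 3 → K) (e : Fin 3 → K) :
    Option (K ⊕ {x // T x = 1}) → Fin 3 → K
  | none => e
  | some (.inl x) => Φ (x, 1)
  | some (.inr x) => Φ (x.1, 0)

theorem exists_tracePoints {T : K →ₗ[L] L} {Φ : K × L →ₗ[L] Fin 3 → K} {e : Fin 3 → K}
    (he : ∀ x, T x = 0 → Φ (x, 0) = x • e) {y : K × L} (hy : y ≠ 0) :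
    ∃ i, ∃ c : K, c ≠ 0 ∧ Φ y = c • tracePoints T Φ e i := by
  obtain ⟨x, m⟩ := y
  have hscale : ∀ l : L, l ≠ 0 → Φ (x, m) = algebraMap L K l • Φ (l⁻¹ • x, l⁻¹ * m) :=
    fun l hl => by
      rw [algebraMap_smul, ← map_smul, Prod.smul_mk, smul_smul, mul_inv_cancel₀ hl, one_smul,
        smul_eq_mul, mul_inv_cancel_left₀ hl]
  by_cases hm : m = 0
  · subst hm
    by_cases hx : T x = 0
    · exact ⟨none, x, fun h => hy (by simp [h]), he x hx⟩
    · refine ⟨some (.inr ⟨(T x)⁻¹ • x, by simp [hx]⟩), algebraMap L K (T x), by simpa using hx, ?_⟩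
      rw [hscale _ hx, mul_zero]
      rfl
  · refine ⟨some (.inl (m⁻¹ • x)), algebraMap L K m, by simpa using hm, ?_⟩
    rw [hscale _ hm, inv_mul_cancel₀ hm]
    rfl

theorem hasPairCover_trace [Finite K] {F : Type*} [Field F] [Algebra K F]
    (hF : Module.finrank K F = 2)
    (h : Nat.card L < Nat.card K) {D : ℕ} (hD : D * Nat.card L = Nat.card K) :
    HasPairCover F 3 (2 * (Nat.card K + D + 1)) (2 * (Nat.card K + D + 1)) := by
  have hfin : Finite L := Finite.of_injective _ (algebraMap L K).injective
  obtain ⟨T, hT⟩ : ∃ T : K →ₗ[L] L, T 1 = 1 := by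
    obtain ⟨f, hf⟩ : ∃ f : Module.Dual L K, f 1 ≠ 0 := by
      by_contra! h
      exact one_ne_zero ((Module.forall_dual_apply_eq_zero_iff L (1 : K)).1 h)
    exact ⟨(f 1)⁻¹ • f, by simp [hf]⟩
  obtain ⟨d, hd, hTd⟩ : ∃ d, d ≠ 0 ∧ T d = 0 := by
    have hninj : ¬ Function.Injective T := fun hinj =>
      h.not_ge (Nat.card_le_card_of_injective T hinj)
    rw [← LinearMap.ker_eq_bot, ← ne_eq, Submodule.ne_bot_iff] at hninj
    obtain ⟨d, hd, hd0⟩ := hninj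
    exact ⟨d, hd0, hd⟩
  obtain ⟨w, hw⟩ := exists_mul_one_add_smul_ne hT hd hTd
  have hcover := isPairCover_of_disjoint (F := F) hF (traceLinearSet_injective T)
    (twistedTraceLinearSet_injective T w d)
    (fun y z hy c hc => traceLinearSet_ne_smul_twistedTraceLinearSet hT hTd hw hy hc)
    (fun y hy => exists_tracePoints (T := T) (e := ![1, 0, 0])
      (fun x hx => by simp [traceLinearSet_apply, hx]) hy)
    (fun y hy => exists_tracePoints (T := T) (e := ![0, 1, 0])
      (fun x hx => by simp [twistedTraceLinearSet_apply, hx]) hy)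
  have hDcard : Nat.card {x // T x = 1} = D :=
    Nat.eq_of_mul_eq_mul_right Nat.card_pos ((card_fiber_mul_card hT).trans hD.symm)
  have hcard : Nat.card (Option (K ⊕ {x // T x = 1})) = Nat.card K + D + 1 := by
    rw [Finite.card_option, Nat.card_sum, hDcard]
  exact hcover.hasPairCover (by simp) (by rw [Nat.card_sum, hcard]; ring)
    (by rw [Nat.card_sum, hcard]; ring)

end Trace

/-! ### Increasing the codimension -/

/-- There is a surjection onto `X` that separates the values of `c`: extend a set of
representatives of the fibres of `c` to a set with as many elements as `X`, and map every other
element to the representative of its fibre. -/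
theorem exists_surjective_separating {ι κ X : Type*} [Finite ι] [Finite κ] [Finite X] (c : ι → κ)
    (h₁ : Nat.card κ ≤ Nat.card X) (h₂ : Nat.card X ≤ Nat.card ι) :
    ∃ β : ι → X, Function.Surjective β ∧ ∀ i j, c i ≠ c j → β i ≠ β j := by
  classical
  have := Fintype.ofFinite ι
  have := Fintype.ofFinite κ
  let s : Set.range c → ι := fun y => y.2.choose
  have hs : ∀ y, c (s y) = y := fun y => y.2.choose_spec
  let R : Finset ι := Finset.univ.image s
  have hR : R.card ≤ Nat.card X := by
    refine Finset.card_image_le.trans (le_trans ?_ h₁)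
    rw [Finset.card_univ, Nat.card_eq_fintype_card]
    exact Fintype.card_le_of_injective _ Subtype.val_injective
  obtain ⟨S, hRS, hS⟩ := Finset.exists_superset_card_eq hR
    (by rwa [← Nat.card_eq_fintype_card])
  have hmem : ∀ i, s ⟨c i, i, rfl⟩ ∈ S := fun i => hRS (Finset.mem_image_of_mem s (by simp))
  let ρ : ι → S := fun i => if h : i ∈ S then ⟨i, h⟩ else ⟨s ⟨c i, i, rfl⟩, hmem i⟩
  have hρ : ∀ i, c (ρ i) = c i := fun i => by
    by_cases h : i ∈ S
    · simp [ρ, h]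
    · simp [ρ, h, hs]
  obtain ⟨e⟩ : Nonempty (S ≃ X) := Finite.card_eq.1 (by simpa using hS)
  refine ⟨fun i => e (ρ i), fun x => ⟨e.symm x, ?_⟩, fun i j hij h => hij ?_⟩
  · simp [ρ]
  · rw [← hρ i, ← hρ j, e.injective h]

section Concat

variable {F : Type*} [Field F] [Finite F]

theorem HasPairCover.concat {r N P : ℕ} (h : HasPairCover F r N P) {m : ℕ} (hm : m ≠ 0)
    (hP : P ≤ Nat.card F ^ m + 1) (hN : Nat.card F ^ m + 1 ≤ N) :
    HasPairCover F (r + 2 * m) (N * Nat.card F ^ m) (2 * P) := by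
  obtain ⟨p, hchar⟩ := CharP.exists F
  have : Fact p.Prime := ⟨CharP.char_is_prime F p⟩
  have : NeZero m := ⟨hm⟩
  let E := FiniteField.Extension F p m
  have hE : Nat.card E = Nat.card F ^ m := FiniteField.natCard_extension F p m
  have hE' : Module.finrank F E = m := FiniteField.finrank_extension F p m
  have hfin : Finite E := inferInstanceAs (Finite (FiniteField.Extension F p m))
  obtain ⟨g, c, hg⟩ := h
  obtain ⟨β, hβ, hc⟩ := exists_surjective_separating (X := Option E) c
    (by rwa [Finite.card_option, hE, Nat.card_fin]) (by rwa [Finite.card_option, hE, Nat.card_fin])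
  refine (hg.concat β hβ hc).hasPairCover ?_ ?_ ?_
  · rw [Module.finrank_prod, Module.finrank_prod, hE', Module.finrank_fin_fun]
    ring
  · rw [Nat.card_prod, Nat.card_fin, hE]
  · rw [Nat.card_prod, Nat.card_fin, Nat.card_eq_fintype_card (α := Prop), Fintype.card_prop]
    ring

theorem HasPairCover.concat_of_le {r N P : ℕ} (h : HasPairCover F r N P) (h₂ : 2 ≤ N)
    (hN : N ≤ Nat.card F + 1) : HasPairCover F (r + 2) (N * Nat.card F + 2) (N + 2) := by
  obtain ⟨g, c, hg⟩ := h
  have hg' : IsPairCover F g (id : Fin N → Fin N) := fun v hv => by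
    obtain ⟨i, j, hij, h⟩ := hg v hv
    exact ⟨i, j, fun h => hij (congrArg c h), h⟩
  obtain ⟨β⟩ : Nonempty (Fin N ↪ Option F) := by
    have := Fintype.ofFinite F
    refine Function.Embedding.nonempty_of_card_le ?_
    rwa [Fintype.card_fin, Fintype.card_option, ← Nat.card_eq_fintype_card]
  refine (hg'.concat_of_injective β β.injective (i₀ := ⟨0, by omega⟩) (i₁ := ⟨1, by omega⟩)
    (by simp)).hasPairCover ?_ ?_ ?_
  · simp
  · simp
  · simp

/-- Repeated concatenation, starting from a short family of `n₀` vectors in `F ^ 3`. The case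
`k = j + m + 1` is obtained from the case `j` with the spread of `E × E` for `[E : F] = m + 1`.
Taking `j` and `m` about equal, there are at most as many spread members as vectors and at least
as many as classes. -/
theorem HasPairCover.exists_codim {n₀ P₀ : ℕ} (h : HasPairCover F 3 n₀ P₀) (h₂ : 2 ≤ n₀)
    (hn₀ : 2 * (n₀ + 2) ≤ Nat.card F + 1) (k : ℕ) :
    ∃ P ≤ Nat.card F ^ (k + 1) + 1,
      HasPairCover F (2 * k + 7) (Nat.card F ^ (k + 1) * (n₀ * Nat.card F + 2)) P := by
  have hq : 1 < Nat.card F := Finite.one_lt_card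
  set q := Nat.card F with hqdef
  induction k using Nat.strong_induction_on with
  | _ k ih =>
    rcases Nat.eq_zero_or_pos k with rfl | hk
    · have h₁ := (h.concat_of_le h₂ (by omega)).concat (m := 1) one_ne_zero
        (by rw [pow_one]; omega) (by rw [pow_one]; nlinarith)
      refine ⟨2 * (n₀ + 2), by simpa using hn₀, ?_⟩
      rw [← hqdef, mul_comm _ (q ^ 1)] at h₁
      exact h₁
    · obtain ⟨j, m, hj, hm, rfl⟩ : ∃ j m, j ≤ m ∧ m ≤ j + 1 ∧ k = j + m + 1 :=
        ⟨(k - 1) / 2, k / 2, by omega, by omega, by omega⟩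
      obtain ⟨P, hP, hcov⟩ := ih j (by omega)
      have h₁ : q ^ (j + 1) ≤ q ^ (m + 1) := Nat.pow_le_pow_right hq.le (by omega)
      have h₂ : q ^ (m + 1) ≤ q ^ (j + 1) * q := by
        rw [← pow_succ]
        exact Nat.pow_le_pow_right hq.le (by omega)
      have h₃ : q ^ (j + 1) * q ≤ q ^ (j + m + 1 + 1) := by
        rw [← pow_succ]
        exact Nat.pow_le_pow_right hq.le (by omega)
      -- `hn₀` and `2 ≤ n₀` imply `7 ≤ q`, which absorbs the doubling of the number of classes.
      have h₄ : 1 ≤ q ^ (j + 1) := Nat.one_le_pow _ _ (by omega)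
      have h₅ : q ^ (j + 1) * 7 ≤ q ^ (j + 1) * q := Nat.mul_le_mul_left _ (by omega)
      have h₆ : q ^ (j + 1) * (q + 2) ≤ q ^ (j + 1) * (n₀ * q + 2) :=
        Nat.mul_le_mul_left _ (by nlinarith)
      refine ⟨2 * P, by omega, ?_⟩
      have hnext := hcov.concat (m := m + 1) m.succ_ne_zero (by rw [← hqdef]; omega)
        (by rw [← hqdef]; rw [mul_add] at h₆; omega)
      rw [← hqdef] at hnext
      convert! hnext using 1 <;> ring

end Concat

/-! ### Lengths -/

/-- The correction term `f_q(2 k + 3, 2)` as a natural number. -/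
def correction (q k : ℕ) : ℕ :=
  if k = 3 then q + 1 else if k = 5 then q ^ 3 + q ^ 2 else 0

theorem lengthCorrection_two_eq (q k : ℕ) :
    lengthCorrection q ((2 * k + 3 : ℕ) : ℝ) 2 = correction q k := by
  have h₉ : ((2 * k + 3 : ℕ) : ℝ) = 9 * 2 / 2 ↔ k = 3 := by
    rw [show (9 * 2 / 2 : ℝ) = ((9 : ℕ) : ℝ) by norm_num, Nat.cast_inj]
    omega
  have h₁₃ : ((2 * k + 3 : ℕ) : ℝ) = 13 * 2 / 2 ↔ k = 5 := by
    rw [show (13 * 2 / 2 : ℝ) = ((13 : ℕ) : ℝ) by norm_num, Nat.cast_inj]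
    omega
  unfold lengthCorrection correction
  simp only [h₉, h₁₃]
  by_cases h₃ : k = 3
  · subst h₃
    norm_num
  by_cases h₅ : k = 5
  · subst h₅
    norm_num
  · simp [h₃, h₅]

theorem rpow_sub_two_div_two {q : ℕ} (k : ℕ) (hq : 0 < q) :
    (q : ℝ) ^ ((((2 * k + 3 : ℕ) : ℝ) - 2) / 2) = Real.sqrt q * q ^ k := by
  have hq' : (0 : ℝ) < q := by exact_mod_cast hq
  rw [Real.sqrt_eq_rpow, ← Real.rpow_natCast, ← Real.rpow_add hq']
  congr 1
  push_cast
  ring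

theorem floor_rpow_zero {q : ℕ} (hq : 1 < q) :
    ⌊(q : ℝ) ^ ((((2 * 0 + 3 : ℕ) : ℝ) - 5) / 2)⌋ = 0 := by
  have hq' : (1 : ℝ) < q := by exact_mod_cast hq
  rw [Int.floor_eq_zero_iff]
  exact ⟨by positivity, Real.rpow_lt_one_of_one_lt_of_neg hq' (by norm_num)⟩

theorem floor_rpow_succ (q k : ℕ) :
    ⌊(q : ℝ) ^ ((((2 * (k + 1) + 3 : ℕ) : ℝ) - 5) / 2)⌋ = (q : ℤ) ^ k := by
  have : (((2 * (k + 1) + 3 : ℕ) : ℝ) - 5) / 2 = (k : ℕ) := by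
    push_cast
    ring
  rw [this, Real.rpow_natCast]
  exact_mod_cast Int.floor_intCast ((q : ℤ) ^ k)

theorem correction_le {q : ℕ} (hq : 1 ≤ q) (k : ℕ) : correction q k ≤ 2 * q ^ k := by
  have hpow : ∀ {i j}, i ≤ j → q ^ i ≤ q ^ j := fun h => Nat.pow_le_pow_right hq h
  unfold correction
  split_ifs with h₃ h₅
  · subst h₃
    have h₁ := hpow (show 1 ≤ 3 by norm_num)
    have h₀ := hpow (show 0 ≤ 3 by norm_num)
    rw [pow_one] at h₁
    rw [pow_zero] at h₀
    omega
  · subst h₅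
    have h₁ := hpow (show 3 ≤ 5 by norm_num)
    have h₂ := hpow (show 2 ≤ 5 by norm_num)
    omega
  · exact Nat.zero_le _

/-- Padding by zero columns reaches the required length also when the correction term is not
zero: the concatenation yields shorter codes then. -/
theorem HasPairCover.exists_isCode_length {F : Type*} [Field F] [Finite F] {n₀ : ℕ}
    (h : HasPairCover F 3 n₀ n₀) (h₂ : 2 ≤ n₀) (hn₀ : 2 * (n₀ + 2) ≤ Nat.card F + 1) (k : ℕ) :
    ∃ (n : ℕ) (C : Submodule F (Fin n → F)), IsCode C (2 * k + 3) 2 ∧ (n : ℝ) =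
      n₀ * (Nat.card F : ℝ) ^ k +
        2 * (⌊(Nat.card F : ℝ) ^ ((((2 * k + 3 : ℕ) : ℝ) - 5) / 2)⌋ : ℝ) +
        lengthCorrection (Nat.card F) ((2 * k + 3 : ℕ) : ℝ) 2 := by
  have hq : 1 < Nat.card F := Finite.one_lt_card
  set q := Nat.card F with hqdef
  have hcount : ∀ n, n ≤ (n₀ + 4) * q ^ k → n * q < q ^ (2 * k + 3) := fun n hn => by
    calc n * q ≤ (n₀ + 4) * q ^ k * q := Nat.mul_le_mul_right _ hn
      _ ≤ q * q ^ k * q := by gcongr; omega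
      _ = q ^ (k + 2) := by ring
      _ < q ^ (2 * k + 3) := Nat.pow_lt_pow_right hq (by omega)
  rcases k with - | k
  · obtain ⟨C, hC⟩ := h.exists_isCode (n := n₀) (by norm_num) le_rfl
      (hcount n₀ (by simp))
    refine ⟨n₀, C, hC, ?_⟩
    rw [lengthCorrection_two_eq, floor_rpow_zero hq]
    simp [correction]
  · obtain ⟨P, N, hN, hcov⟩ : ∃ P N, N ≤ n₀ * q ^ (k + 1) + 2 * q ^ k + correction q (k + 1) ∧
        HasPairCover F (2 * (k + 1) + 3) N P := by
      rcases k with - | k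
      · exact ⟨_, _, by simp [correction, ← hqdef], h.concat_of_le h₂ (by omega)⟩
      · obtain ⟨P, -, hP⟩ := h.exists_codim h₂ hn₀ k
        refine ⟨P, _, ?_, hP⟩
        rw [← hqdef]
        refine le_of_eq_of_le ?_ (Nat.le_add_right _ _)
        ring
    have hle : n₀ * q ^ (k + 1) + 2 * q ^ k + correction q (k + 1) ≤ (n₀ + 4) * q ^ (k + 1) := by
      have h₁ := correction_le hq.le (k + 1)
      have h₂ : q ^ k ≤ q ^ (k + 1) := Nat.pow_le_pow_right hq.le (by omega)
      rw [add_mul]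
      omega
    obtain ⟨C, hC⟩ := hcov.exists_isCode (by omega) hN (hcount _ hle)
    refine ⟨_, C, hC, ?_⟩
    rw [lengthCorrection_two_eq, floor_rpow_succ]
    push_cast
    ring

/-! ### Subfields -/

theorem exists_algebra_finrank_two {F K : Type*} [Field F] [Finite F] [Field K] [Finite K]
    {p h : ℕ} (hp : p.Prime) (hK : Nat.card K = p ^ h) (hF : Nat.card F = p ^ (2 * h)) :
    ∃ _ : Algebra K F, Module.finrank K F = 2 := by
  have := Fintype.ofFinite F
  have := Fintype.ofFinite K
  have : Fact p.Prime := ⟨hp⟩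
  rw [Nat.card_eq_fintype_card] at hK hF
  have := charP_of_card_eq_prime_pow hK
  have := charP_of_card_eq_prime_pow hF
  let _ : Algebra (ZMod p) K := ZMod.algebra K p
  let _ : Algebra (ZMod p) F := ZMod.algebra F p
  have hpow := Nat.pow_right_injective hp.two_le
  have hK' : Module.finrank (ZMod p) K = h :=
    hpow ((FiniteField.pow_finrank_eq_card p K).trans hK)
  have hF' : Module.finrank (ZMod p) F = 2 * h :=
    hpow ((FiniteField.pow_finrank_eq_card p F).trans hF)
  obtain ⟨f⟩ := FiniteField.nonempty_algHom_of_finrank_dvd (F := ZMod p) (K := K) (L := F)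
    (by rw [hK', hF']; exact Nat.dvd_mul_left h 2)
  let _ : Algebra K F := f.toRingHom.toAlgebra
  refine ⟨inferInstance, Nat.pow_right_injective (Finite.one_lt_card (α := K)) ?_⟩
  change Nat.card K ^ _ = Nat.card K ^ 2
  rw [← Module.natCard_eq_pow_finrank, Nat.card_eq_fintype_card, Nat.card_eq_fintype_card, hK, hF]
  ring

theorem exists_subfield_card_eq {K : Type*} [Field K] [Finite K] {p h : ℕ} (hp : p.Prime)
    (hh : 2 ≤ h) (hK : Nat.card K = p ^ h) :
    ∃ L : Subfield K, Nat.card L < Nat.card K ∧ Nat.card L = largestProperSubfieldOrder K := by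
  have := Fintype.ofFinite K
  have : Fact p.Prime := ⟨hp⟩
  have hK' := hK
  rw [Nat.card_eq_fintype_card] at hK'
  have := charP_of_card_eq_prime_pow hK'
  have hlt : p < Nat.card K := by
    rw [hK]
    exact lt_self_pow₀ hp.one_lt (by omega)
  have hne : (ZMod.castHom dvd_rfl K : ZMod p →+* K).fieldRange ≠ ⊤ := fun htop => by
    rw [RingHom.fieldRange_eq_top_iff] at htop
    have := Nat.card_le_card_of_surjective _ htop
    rw [Nat.card_zmod] at this
    omega
  have hcard : ∀ L : Subfield K, L ≠ ⊤ → Nat.card L < Nat.card K := fun L hL => by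
    refine lt_of_le_of_ne (Nat.card_le_card_of_injective _ Subtype.val_injective) fun heq => hL ?_
    have hbij := (Nat.bijective_iff_injective_and_card (Subtype.val : L → K)).2
      ⟨Subtype.val_injective, heq⟩
    refine eq_top_iff.2 fun x _ => ?_
    obtain ⟨y, rfl⟩ := hbij.2 x
    exact y.2
  obtain ⟨L, hL, hLcard⟩ := Nat.sSup_mem (s := {m : ℕ | ∃ L : Subfield K, L ≠ ⊤ ∧ Nat.card L = m})
    ⟨_, _, hne, rfl⟩ ⟨Nat.card K, by rintro _ ⟨L, hL, rfl⟩; exact (hcard L hL).le⟩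
  exact ⟨L, hcard L hL, hLcard⟩

/-- The first family, with a blocking set of Frobenius type over any proper subfield. -/
theorem exists_isCode_of_subfield {F K : Type*} [Field F] [Finite F] [Field K] [Finite K]
    {p h : ℕ} (hp : p.Prime) (hh : 2 ≤ h) (hp3 : 3 ≤ p) (hK : Nat.card K = p ^ h)
    (hF : Nat.card F = p ^ (2 * h)) {L : Subfield K} (hL : Nat.card L < Nat.card K) (k : ℕ) :
    ∃ (n : ℕ) (C : Submodule F (Fin n → F)), IsCode C (2 * k + 3) 2 ∧ (n : ℝ) =
      2 * (Nat.card K + (Nat.card K - 1) / ((Nat.card L : ℝ) - 1)) * (Nat.card F : ℝ) ^ k +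
        2 * (⌊(Nat.card F : ℝ) ^ ((((2 * k + 3 : ℕ) : ℝ) - 5) / 2)⌋ : ℝ) +
        lengthCorrection (Nat.card F) ((2 * k + 3 : ℕ) : ℝ) 2 := by
  obtain ⟨_, hrank⟩ := exists_algebra_finrank_two hp hK hF
  have := Fintype.ofFinite L
  have hL₁ : 1 < Nat.card L := Finite.one_lt_card
  have hL₃ : 3 ≤ Nat.card L := by
    by_contra hlt
    have hL₂ : Nat.card L = 2 := by omega
    have hpow := Module.natCard_eq_pow_finrank (K := L) (V := K)
    have hdvd : 2 ∣ p ^ h := by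
      rw [← hK, hpow, hL₂]
      exact dvd_pow_self 2 Module.finrank_pos.ne'
    have := (Nat.prime_dvd_prime_iff_eq Nat.prime_two hp).1 (Nat.prime_two.dvd_of_dvd_pow hdvd)
    omega
  have hcov := hasPairCover_frobenius (L := L) hrank (by rwa [← Nat.card_eq_fintype_card])
  set M := Nat.card (Projectivization L (K × L)) with hMdef
  have hM : M * (Nat.card L - 1) = Nat.card K * Nat.card L - 1 := by
    rw [hMdef, ← Projectivization.card, Nat.card_prod]
  have hKF : Nat.card F = Nat.card K * Nat.card K := by
    rw [hK, hF]
    ring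
  have hK₉ : 9 ≤ Nat.card K := by
    rw [hK]
    calc 9 = 3 ^ 2 := by norm_num
      _ ≤ p ^ 2 := Nat.pow_le_pow_left hp3 2
      _ ≤ p ^ h := Nat.pow_le_pow_right hp.pos hh
  obtain ⟨l, hl⟩ : ∃ l, Nat.card L = l + 3 := ⟨_, (Nat.sub_add_cancel hL₃).symm⟩
  obtain ⟨s, hs⟩ : ∃ s, Nat.card K = s + 9 := ⟨_, (Nat.sub_add_cancel hK₉).symm⟩
  have hM' : M * (l + 2) + 1 = (s + 9) * (l + 3) := by
    rw [hl, hs] at hM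
    have : 0 < (s + 9) * (l + 3) := by positivity
    have h₁ : l + 3 - 1 = l + 2 := rfl
    rw [h₁] at hM
    omega
  have hM₁ : s + 9 ≤ M := by
    by_contra hlt
    have : M + 1 ≤ s + 9 := by omega
    nlinarith
  have hM₂ : 2 * M + 1 ≤ 3 * (s + 9) := by
    obtain ⟨D, hMD⟩ := Nat.exists_eq_add_of_le hM₁
    rw [hMD] at hM' ⊢
    have hD : D * (l + 2) = s + 8 := by nlinarith
    nlinarith
  obtain ⟨n, C, hC, hn⟩ := hcov.exists_isCode_length (by omega) (by rw [hKF, hs]; nlinarith) k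
  refine ⟨n, C, hC, ?_⟩
  rw [hn]
  have hMR : (M : ℝ) * (l + 2) + 1 = (s + 9) * (l + 3) := by exact_mod_cast hM'
  have hl2 : (l : ℝ) + 3 - 1 ≠ 0 := by
    have : (0 : ℝ) ≤ l := Nat.cast_nonneg l
    linarith
  have : ((2 * M : ℕ) : ℝ) =
      2 * (Nat.card K + (Nat.card K - 1) / ((Nat.card L : ℝ) - 1)) := by
    rw [hl, hs]
    push_cast
    field_simp
    linear_combination hMR
  rw [this]

/-- The second family, with a blocking set of trace type over the prime field. -/
theorem exists_isCode_of_prime {F K : Type*} [Field F] [Finite F] [Field K] [Finite K]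
    {p h : ℕ} (hp : p.Prime) (hh : 2 ≤ h) (hp7 : 7 ≤ p) (hK : Nat.card K = p ^ h)
    (hF : Nat.card F = p ^ (2 * h)) (k : ℕ) :
    ∃ (n : ℕ) (C : Submodule F (Fin n → F)), IsCode C (2 * k + 3) 2 ∧ (n : ℝ) =
      2 * (Nat.card K + Nat.card K / (p : ℝ) + 1) * (Nat.card F : ℝ) ^ k +
        2 * (⌊(Nat.card F : ℝ) ^ ((((2 * k + 3 : ℕ) : ℝ) - 5) / 2)⌋ : ℝ) +
        lengthCorrection (Nat.card F) ((2 * k + 3 : ℕ) : ℝ) 2 := by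
  obtain ⟨_, hrank⟩ := exists_algebra_finrank_two hp hK hF
  have := Fintype.ofFinite K
  have : Fact p.Prime := ⟨hp⟩
  have hK' := hK
  rw [Nat.card_eq_fintype_card] at hK'
  have := charP_of_card_eq_prime_pow hK'
  let _ : Algebra (ZMod p) K := ZMod.algebra K p
  obtain ⟨j, rfl⟩ : ∃ j, h = j + 2 := ⟨_, (Nat.sub_add_cancel hh).symm⟩
  have hD : p ^ (j + 1) * Nat.card (ZMod p) = Nat.card K := by
    rw [hK, Nat.card_zmod]
    ring
  have hKF : Nat.card F = Nat.card K * Nat.card K := by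
    rw [hK, hF]
    ring
  have hDp : p ≤ p ^ (j + 1) := Nat.le_self_pow (by omega) p
  rw [Nat.card_zmod] at hD
  have hcov := hasPairCover_trace (L := ZMod p) hrank (by rw [Nat.card_zmod, ← hD]; nlinarith)
    (by rwa [Nat.card_zmod])
  obtain ⟨n, C, hC, hn⟩ := hcov.exists_isCode_length (by omega)
    (by rw [hKF, ← hD]; nlinarith [Nat.mul_le_mul hDp hp7, Nat.mul_le_mul hDp hDp]) k
  refine ⟨n, C, hC, ?_⟩
  rw [hn]
  have hp0 : (p : ℝ) ≠ 0 := by exact_mod_cast hp.ne_zero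
  have : ((2 * (Nat.card K + p ^ (j + 1) + 1) : ℕ) : ℝ) =
      2 * (Nat.card K + Nat.card K / (p : ℝ) + 1) := by
    rw [← hD]
    push_cast
    field_simp
  rw [this]

end CoveringCode

theorem mainTheorem10 {F K : Type*} [Field F] [Finite F] [Field K] [Finite K]
    (p h q : ℕ) (hp : p.Prime) (hh : 2 ≤ h) (hq : q = p ^ (2 * h))
    (hF : Nat.card F = q) (hK : (Nat.card K : ℝ) = Real.sqrt q) :
    (3 ≤ p → ∀ t r : ℕ, 1 ≤ t → r = 2 * t + 1 →
      ∃ (n : ℕ) (C : Submodule F (Fin n → F)), CoveringCode.IsCode C r 2 ∧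
        (n : ℝ) =
          (2 + 2 * ((Real.sqrt q - 1) /
              (Real.sqrt q * ((CoveringCode.largestProperSubfieldOrder K : ℝ) - 1))))
            * (q : ℝ) ^ (((r : ℝ) - 2) / 2)
          + 2 * (⌊(q : ℝ) ^ (((r : ℝ) - 5) / 2)⌋ : ℝ)
          + CoveringCode.lengthCorrection q r 2) ∧
    (7 ≤ p → ∀ t r : ℕ, 1 ≤ t → r = 2 * t + 1 →
      ∃ (n : ℕ) (C : Submodule F (Fin n → F)), CoveringCode.IsCode C r 2 ∧
        (n : ℝ) =
          (2 + 2 / (p : ℝ) + 2 / Real.sqrt q) * (q : ℝ) ^ (((r : ℝ) - 2) / 2)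
          + 2 * (⌊(q : ℝ) ^ (((r : ℝ) - 5) / 2)⌋ : ℝ)
          + CoveringCode.lengthCorrection q r 2) := by
  have hq0 : 0 < q := by rw [hq]; exact pow_pos hp.pos _
  have hKcard : Nat.card K = p ^ h := by
    have : Real.sqrt q = ((p ^ h : ℕ) : ℝ) := by
      rw [hq, mul_comm 2 h, pow_mul, Nat.cast_pow, Real.sqrt_sq (Nat.cast_nonneg _)]
    exact_mod_cast hK.trans this
  have hFcard : Nat.card F = p ^ (2 * h) := hF.trans hq
  have hs : Real.sqrt q ≠ 0 := by
    rw [← hK]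
    exact_mod_cast Nat.card_pos.ne'
  constructor
  · rintro hp3 t r ht rfl
    obtain ⟨k, rfl⟩ : ∃ k, t = k + 1 := ⟨_, (Nat.sub_add_cancel ht).symm⟩
    obtain ⟨L, hL, hLφ⟩ := CoveringCode.exists_subfield_card_eq hp hh hKcard
    obtain ⟨n, C, hC, hn⟩ :=
      CoveringCode.exists_isCode_of_subfield hp hh hp3 hKcard hFcard hL k
    refine ⟨n, C, hC, ?_⟩
    have hφ : ((Nat.card L : ℝ) - 1) ≠ 0 := by
      rw [sub_ne_zero]
      exact_mod_cast (Finite.one_lt_card (α := L)).ne'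
    rw [hn, hF, hK, ← hLφ, show 2 * (k + 1) + 1 = 2 * k + 3 by ring,
      CoveringCode.rpow_sub_two_div_two k hq0]
    congr 2
    field_simp
  · rintro hp7 t r ht rfl
    obtain ⟨k, rfl⟩ : ∃ k, t = k + 1 := ⟨_, (Nat.sub_add_cancel ht).symm⟩
    obtain ⟨n, C, hC, hn⟩ := CoveringCode.exists_isCode_of_prime hp hh hp7 hKcard hFcard k
    refine ⟨n, C, hC, ?_⟩
    have hp0 : (p : ℝ) ≠ 0 := by exact_mod_cast hp.ne_zero
    rw [hn, hF, hK, show 2 * (k + 1) + 1 = 2 * k + 3 by ring,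
      CoveringCode.rpow_sub_two_div_two k hq0]
    congr 2
    field_simp
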